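/- Let $(\Omega,\mathcal F,\mathbf P)$ be a complete probability space, $\mathcal H\subseteq\mathcal F$ a sub-$\sigma$-algebra, and $\mathfrak X$ a separable real Banach space with Borel $\sigma$-algebra $\mathcal B(\mathfrak X)$. An $\mathcal H$-measurable random set is a map $\omega\mapsto Z(\omega)\subseteq\mathfrak X$ whose graph $\{(\omega,x):x\in Z(\omega)\}$ belongs to $\mathcal H\otimes\mathcal B(\mathfrak X)$ (similarly for $\mathcal F$); it is called closed (convex) if $Z(\omega)$ is closed (convex) for almost all $\omega$. Write $L^0(Z,\mathcal H)$ for the set of $\mathcal H$-measurable random elements $\xi$ in $\mathfrak X$ with $\xi\in Z$ a.s. (the $\mathcal H$-measurable selections of $Z$). Write $L^{1_{\mathcal H}}(Z,\mathcal F)$ for the set of those $\xi\in L^0(Z,\mathcal F)$ for which there is a countable $\mathcal H$-measurable partition $(A_i)_{i\ge1}$ of $\Omega$ such that $\xi 1_{A_i}$ is integrable for every $i$; for such $\xi$ put $\mathbf E^g(\xi|\mathcal H)=\sum_i \mathbf E(\xi 1_{A_i}|\mathcal H)1_{A_i}$, which a.s. does not depend on the partition. Let $X$ be an a.s. non-empty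 $\mathcal F$-measurable random closed set in $\mathfrak X$ with $L^{1_{\mathcal H}}(X,\mathcal F)\neq\emptyset$. Then the following random sets exist: - the conditional core $\mathbf m(X|\mathcal H)$, that is, the largest (up to null sets) $\mathcal H$-measurable random set $Z$ with $Z\subseteq X$ a.s.; - the generalised conditional expectation $\mathbf E^g(X|\mathcal H)$, that is, an $\mathcal H$-measurable random closed set $Y$ such that $L^0(Y,\mathcal H)$ is the closure in probability of $\{\mathbf E^g(\xi|\mathcal H):\xi\in L^{1_{\mathcal H}}(X,\mathcal F)\}$; - the conditional convex hull $\mathbf M(X|\mathcal H)$, that is, the smallest (up to null sets) $\mathcal H$-measurable random convex closed set $Z$ with $X\subseteq Z$ a.s. Moreover, for every choice of versions of these three random sets, $$\mathbf m(X|\mathcal H)\subseteq \mathbf E^g(X|\mathcal H)\subseteq \mathbf M(X|\mathcal H)\quad\text{a.s.}$$ -/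

import Mathlib

open MeasureTheory Filter

namespace RandomSets

variable {Ω E : Type*} [NormedAddCommGroup E] [MeasurableSpace E]

/-- `X` is an `m`-measurable random set: its graph lies in the product `m ⊗ ℬ(E)`. -/
def IsRandomSet (m : MeasurableSpace Ω) (X : Ω → Set E) : Prop :=
  MeasurableSet[m.prod ‹MeasurableSpace E›] {p : Ω × E | p.2 ∈ X p.1}

/-- `X` is an `m`-measurable random closed set: a random set with almost surely closed values. -/
def IsRandomClosedSet (m : MeasurableSpace Ω) [mΩ : MeasurableSpace Ω]
    (μ : Measure Ω) (X : Ω → Set E) : Prop :=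
  IsRandomSet m X ∧ ∀ᵐ ω ∂μ, IsClosed (X ω)

/-- The `m`-measurable selections of `X`: the `m`-measurable random elements that belong to `X`
almost surely. -/
def selections (m : MeasurableSpace Ω) [mΩ : MeasurableSpace Ω]
    (μ : Measure Ω) (X : Ω → Set E) : Set (Ω → E) :=
  {ξ | Measurable[m] ξ ∧ ∀ᵐ ω ∂μ, ξ ω ∈ X ω}

/-- `C` is (a version of) the conditional core of `X` given `H`: the largest, up to null sets,
`H`-measurable random set that is almost surely contained in `X`. -/
structure IsCondCore (H : MeasurableSpace Ω) [mΩ : MeasurableSpace Ω]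
    (μ : Measure Ω) (X C : Ω → Set E) : Prop where
  isRandomSet : IsRandomSet H C
  subset : ∀ᵐ ω ∂μ, C ω ⊆ X ω
  largest : ∀ Z : Ω → Set E, IsRandomSet H Z → (∀ᵐ ω ∂μ, Z ω ⊆ X ω) → ∀ᵐ ω ∂μ, Z ω ⊆ C ω

/-- `M` is (a version of) the conditional convex hull of `X` given `H`: the smallest, up to null
sets, `H`-measurable random convex closed set that almost surely contains `X`. -/
structure IsCondConvexHull [NormedSpace ℝ E] (H : MeasurableSpace Ω) [mΩ : MeasurableSpace Ω]
    (μ : Measure Ω)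
    (X M : Ω → Set E) : Prop where
  isRandomClosedSet : IsRandomClosedSet H μ M
  convex : ∀ᵐ ω ∂μ, Convex ℝ (M ω)
  subset : ∀ᵐ ω ∂μ, X ω ⊆ M ω
  smallest : ∀ Z : Ω → Set E, IsRandomClosedSet H μ Z → (∀ᵐ ω ∂μ, Convex ℝ (Z ω)) →
    (∀ᵐ ω ∂μ, X ω ⊆ Z ω) → ∀ᵐ ω ∂μ, M ω ⊆ Z ω

/-- `A` is a countable `H`-measurable partition of `Ω` (some blocks may be empty) on each block of
which `ξ` is integrable. -/
structure IsIntegrabilityPartition (H : MeasurableSpace Ω) [mΩ : MeasurableSpace Ω]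
    (μ : Measure Ω) (ξ : Ω → E)
    (A : ℕ → Set Ω) : Prop where
  measurableSet : ∀ i, MeasurableSet[H] (A i)
  disjoint : Pairwise fun i j => Disjoint (A i) (A j)
  iUnion_eq : ⋃ i, A i = Set.univ
  integrable : ∀ i, Integrable ((A i).indicator ξ) μ

/-- The `H`-conditionally integrable (measurable with respect to the whole `σ`-algebra of `Ω`)
selections of `X`, i.e. those whose generalised conditional expectation given `H` exists. -/
def condIntegrableSelections (H : MeasurableSpace Ω) [mΩ : MeasurableSpace Ω]
    (μ : Measure Ω) (X : Ω → Set E) :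
    Set (Ω → E) :=
  {ξ | ξ ∈ selections mΩ μ X ∧ ∃ A, IsIntegrabilityPartition H μ ξ A}

/-- `η` is an `H`-measurable version of the generalised conditional expectation
`∑ᵢ 𝔼(ξ 1_{Aᵢ} | H) 1_{Aᵢ}` of the random element `ξ` given `H`. At each point at most one term of
the series is non-zero. -/
def IsGenCondExp [NormedSpace ℝ E] [CompleteSpace E] (H : MeasurableSpace Ω) [mΩ : MeasurableSpace Ω]
    (μ : Measure Ω)
    (ξ η : Ω → E) : Prop :=
  Measurable[H] η ∧ ∃ A, IsIntegrabilityPartition H μ ξ A ∧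
    η =ᵐ[μ] fun ω => ∑' i, (A i).indicator (μ[(A i).indicator ξ | H]) ω

/-- The closure in probability of a family `Ξ` of `H`-measurable random elements. A limit in
probability of such elements has an `H`-measurable version, and exactly these versions are
collected. -/
def closureInProbability (H : MeasurableSpace Ω) [mΩ : MeasurableSpace Ω]
    (μ : Measure Ω) (Ξ : Set (Ω → E)) :
    Set (Ω → E) :=
  {η | Measurable[H] η ∧ ∃ u : ℕ → Ω → E, (∀ n, u n ∈ Ξ) ∧ TendstoInMeasure μ u atTop η}

/-- `Y` is (a version of) the generalised conditional expectation of the random closed set `X`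
given `H`: the `H`-measurable random closed set whose `H`-measurable selections are the closure in
probability of the generalised conditional expectations of the `H`-conditionally integrable
selections of `X`. It is only used for `X` that have such a selection. -/
structure IsGenCondExpSet [NormedSpace ℝ E] [CompleteSpace E] (H : MeasurableSpace Ω) [mΩ : MeasurableSpace Ω]
    (μ : Measure Ω) (X Y : Ω → Set E) : Prop where
  isRandomClosedSet : IsRandomClosedSet H μ Y
  selections_eq : selections H μ Y =
    closureInProbability H μ {η | ∃ ξ ∈ condIntegrableSelections H μ X, IsGenCondExp H μ ξ η}

end RandomSets

/-! Existence rests on measurable selection and exhaustion. The graph of an `H`-measurable random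
set is pulled back from a Borel subset of the Cantor space times `E`, which is empty or a continuous
image of the Baire space. If the random set is non-empty with positive outer probability, a compact
piece of the Baire space retains positive mass, and on compact fibres a least point can be chosen
measurably (`IsRandomSet.exists_partial_selection`). Hence inclusions can be tested on partial
selections (`IsRandomSet.ae_subset`).

For each member `B k` of a countable base, `exists_ae_largest` gives a largest event on which,
respectively, `X ∩ B k` has an `H`-measurable selection, some conditional expectation lies in `B k`,
or some admissible convex set misses `B k`. The closure of the countably many maximisers gives the
core and the conditional expectation; their intersection gives the hull.

For the inclusions, an `H`-measurable selection is its own generalised conditional expectation,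
which puts the core inside `Y`. A conditional expectation is a mean of a conditional law carried by
the closed convex set `M ω`, so it stays there, and limits in probability do not leave `M`. -/

namespace RandomSets

/-! ### Measurable selection on an event of positive probability -/

section Selection

/-- Outer measures are continuous along increasing sequences, so the coordinates can be bounded
one after the other without losing more than a prescribed amount of mass of the image. -/
theorem exists_bounds_lt_measure_image {S : Type*} [MeasurableSpace S] (ν : Measure S)
    (p : (ℕ → ℕ) → S) {δ : ENNReal} (h : δ < ν (Set.range p)) :
    ∃ k : ℕ → ℕ, ∀ n, δ < ν (p '' {x | ∀ i < n, x i ≤ k i}) := by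
  have step : ∀ (n : ℕ) (N : {N : Set (ℕ → ℕ) // δ < ν (p '' N)}),
      ∃ j, δ < ν (p '' (N.1 ∩ {x | x n ≤ j})) := by
    intro n N
    have hmono : Monotone fun j => p '' (N.1 ∩ {x | x n ≤ j}) := fun a b hab =>
      Set.image_mono fun x hx => ⟨hx.1, le_trans hx.2 hab⟩
    have hU : p '' N.1 = ⋃ j, p '' (N.1 ∩ {x | x n ≤ j}) := by
      rw [← Set.image_iUnion, ← Set.inter_iUnion]
      congr 1
      ext x
      simp only [Set.mem_inter_iff, Set.mem_iUnion, Set.mem_ofPred_eq]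
      exact ⟨fun hx => ⟨hx, x n, le_rfl⟩, fun hx => hx.1⟩
    have := N.2
    rw [hU, hmono.measure_iUnion] at this
    exact lt_iSup_iff.1 this
  choose j hj using step
  let N : ℕ → {N : Set (ℕ → ℕ) // δ < ν (p '' N)} := fun n =>
    Nat.rec ⟨Set.univ, by rwa [Set.image_univ]⟩
      (fun n N => ⟨N.1 ∩ {x | x n ≤ j n N}, hj n N⟩) n
  refine ⟨fun n => j n (N n), fun n => ?_⟩
  have hN : (N n).1 = {x | ∀ i < n, x i ≤ j i (N i)} := by
    induction n with
    | zero => simp [N]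
    | succ n ih =>
      have : (N (n + 1)).1 = (N n).1 ∩ {x | x n ≤ j n (N n)} := rfl
      rw [this, ih]
      ext x
      simp only [Set.mem_inter_iff, Set.mem_ofPred_eq, Nat.lt_succ_iff_lt_or_eq]
      exact ⟨fun h i hi => hi.elim (h.1 i) (fun e => e ▸ h.2),
        fun h => ⟨fun i hi => h i (Or.inl hi), h n (Or.inr rfl)⟩⟩
  rw [← hN]
  exact (N n).2

theorem isCompact_setOf_forall_le (k : ℕ → ℕ) : IsCompact {x : ℕ → ℕ | ∀ i, x i ≤ k i} := by
  have := isCompact_univ_pi (s := fun i => Set.Iic (k i)) fun i => (Set.finite_Iic _).isCompact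
  convert this using 1
  ext x
  simp [Pi.le_def]

/-- Truncating counterexamples at `k` puts them in a compact set. Each fixed coordinate is
eventually unaffected, so the untruncated points have the same subsequential limit. -/
theorem exists_setOf_forall_lt_le_subset (k : ℕ → ℕ) {U : Set (ℕ → ℕ)} (hU : IsOpen U)
    (hK : {x : ℕ → ℕ | ∀ i, x i ≤ k i} ⊆ U) : ∃ n, {x : ℕ → ℕ | ∀ i < n, x i ≤ k i} ⊆ U := by
  by_contra! hcon
  simp only [Set.not_subset] at hcon
  choose x hx hxU using hcon
  obtain ⟨a, ha, φ, hφ, hlim⟩ := (isCompact_setOf_forall_le k).tendsto_subseq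
    (x := fun n i => min (x n i) (k i)) fun n i => min_le_right _ _
  have hx' : Tendsto (x ∘ φ) atTop (nhds a) := by
    rw [tendsto_pi_nhds] at hlim ⊢
    intro i
    refine (hlim i).congr' ?_
    filter_upwards [eventually_gt_atTop i] with n hn
    exact min_eq_left (hx _ i (hn.trans_le hφ.le_apply))
  obtain ⟨n, hn⟩ := (hx'.eventually (hU.mem_nhds (hK ha))).exists
  exact hxU _ hn

/-- Every finite stage of the coordinate bounds keeps image mass above `δ`. An open set of mass
below `δ` around the image of the compact limit would already contain the image of a finite stage.
-/
theorem exists_isCompact_lt_measure_image {S : Type*} [TopologicalSpace S] [MeasurableSpace S]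
    (ν : Measure S) [ν.OuterRegular] {p : (ℕ → ℕ) → S} (hp : Continuous p)
    (h : ν (Set.range p) ≠ 0) : ∃ K, IsCompact K ∧ ν (p '' K) ≠ 0 := by
  obtain ⟨δ, h0, hδ⟩ := exists_between (pos_iff_ne_zero.2 h)
  obtain ⟨k, hk⟩ := exists_bounds_lt_measure_image ν p hδ
  refine ⟨_, isCompact_setOf_forall_le k, (h0.trans_le ?_).ne'⟩
  by_contra! hlt
  obtain ⟨U, hKU, hU, hνU⟩ := Set.exists_isOpen_lt_of_lt _ _ hlt
  obtain ⟨n, hn⟩ := exists_setOf_forall_lt_le_subset k (hU.preimage hp) (Set.image_subset_iff.1 hKU)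
  exact absurd ((hk n).trans_le (measure_mono (Set.image_subset_iff.2 hn))) hνU.not_gt

/-- Each sequence is encoded by the indicator of its graph, a point of the Cantor set. This gives
compact sets of sequences a least element. -/
theorem exists_continuous_injective_real :
    ∃ φ : (ℕ → ℕ) → ℝ, Continuous φ ∧ Function.Injective φ := by
  let ψ : (ℕ → ℕ) → ℕ → Bool := fun x n => decide (x n.unpair.1 = n.unpair.2)
  refine ⟨fun x => (cantorSetHomeomorphNatToBool.symm (ψ x) : ℝ), ?_, ?_⟩
  · refine continuous_subtype_val.comp (cantorSetHomeomorphNatToBool.symm.continuous.comp ?_)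
    refine continuous_pi fun n => ?_
    exact (continuous_of_discreteTopology (f := fun m : ℕ => decide (m = n.unpair.2))).comp
      (continuous_apply n.unpair.1)
  · intro x y hxy
    have h : ψ x = ψ y := cantorSetHomeomorphNatToBool.symm.injective (Subtype.ext hxy)
    funext i
    have := congrFun h (Nat.pair i (x i))
    simp only [ψ, Nat.unpair_pair, decide_true] at this
    exact (of_decide_eq_true this.symm).symm

theorem exists_measurable_section_of_isCompact {S : Type*} [TopologicalSpace S] [T2Space S]
    [MeasurableSpace S] [BorelSpace S] {p : (ℕ → ℕ) → S} (hp : Continuous p) {K : Set (ℕ → ℕ)}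
    (hK : IsCompact K) :
    ∃ s : S → ℕ → ℕ, Measurable s ∧ ∀ ω ∈ p '' K, s ω ∈ K ∧ p (s ω) = ω := by
  obtain ⟨φ, hφ, hinj⟩ := exists_continuous_injective_real
  obtain ⟨r, hr, hrφ⟩ := (hφ.measurableEmbedding hinj).exists_measurable_extend measurable_id
    fun _ => inferInstance
  let F : S → Set ℝ := fun ω => φ '' (K ∩ p ⁻¹' {ω})
  have hF : ∀ ω, IsCompact (F ω) := fun ω =>
    (hK.inter_right (isClosed_singleton.preimage hp)).image hφ
  have hmem : ∀ ω ∈ p '' K, sInf (F ω) ∈ F ω := by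
    rintro ω ⟨x, hx, rfl⟩
    exact (hF _).sInf_mem ⟨φ x, x, ⟨hx, rfl⟩, rfl⟩
  have hempty : ∀ ω, ω ∉ p '' K → F ω = ∅ := by
    intro ω hω
    simp only [F, Set.image_eq_empty]
    ext x
    simp only [Set.mem_inter_iff, Set.mem_preimage, Set.mem_singleton_iff, Set.mem_empty_iff_false,
      iff_false]
    exact fun h => hω ⟨x, h.1, h.2⟩
  have hpK : MeasurableSet (p '' K) := (hK.image hp).isClosed.measurableSet
  have hm : Measurable fun ω => sInf (F ω) := by
    refine measurable_of_Iic fun t => ?_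
    -- Off `p '' K` the infimum is that of the empty set, namely `0`; this is the second term.
    have : (fun ω => sInf (F ω)) ⁻¹' Set.Iic t =
        p '' (K ∩ φ ⁻¹' Set.Iic t) ∪ ((p '' K)ᶜ ∩ {_ω | (0 : ℝ) ≤ t}) := by
      ext ω
      by_cases hω : ω ∈ p '' K
      · simp only [Set.mem_preimage, Set.mem_Iic, Set.mem_union, Set.mem_inter_iff,
          Set.mem_compl_iff, hω, not_true_eq_false, false_and, or_false]
        constructor
        · intro h
          obtain ⟨x, hx, hxe⟩ := hmem ω hω
          exact ⟨x, ⟨hx.1, by simpa [hxe] using h⟩, hx.2⟩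
        · rintro ⟨x, hx, rfl⟩
          exact (csInf_le (hF _).bddBelow ⟨x, ⟨hx.1, rfl⟩, rfl⟩).trans hx.2
      · have h2 : ω ∉ p '' (K ∩ φ ⁻¹' Set.Iic t) := fun h =>
          hω (Set.image_mono Set.inter_subset_left h)
        simp [hempty ω hω, hω, h2, -Set.mem_image]
    rw [this]
    refine MeasurableSet.union ?_ (hpK.compl.inter (MeasurableSet.const _))
    exact ((hK.inter_right (isClosed_Iic.preimage hφ)).image hp).isClosed.measurableSet
  refine ⟨fun ω => r (sInf (F ω)), hr.comp hm, fun ω hω => ?_⟩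
  obtain ⟨x, hx, hxe⟩ := hmem ω hω
  have : r (sInf (F ω)) = x := by rw [← hxe]; exact congrFun hrφ x
  change r (sInf (F ω)) ∈ K ∧ p (r (sInf (F ω))) = ω
  rw [this]
  exact hx

/-- A set in a product `σ`-algebra is the preimage of a measurable set under a map to the Cantor
space in the first coordinate. -/
theorem exists_preimage_of_measurableSet_prod {Ω E : Type*} [mΩ : MeasurableSpace Ω]
    [MeasurableSpace E] {G : Set (Ω × E)} (hG : MeasurableSet G) :
    ∃ f : Ω → ℕ → Bool, Measurable f ∧ ∃ G' : Set ((ℕ → Bool) × E), MeasurableSet G' ∧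
      G = Prod.map f id ⁻¹' G' := by
  classical
  induction G, hG using MeasurableSpace.induction_on_inter generateFrom_prod.symm
    isPiSystem_prod with
  | empty => exact ⟨fun _ _ => true, measurable_const, ∅, .empty, rfl⟩
  | basic G hG =>
    obtain ⟨A, hA, B, hB, rfl⟩ := hG
    refine ⟨fun ω _ => decide (ω ∈ A), measurable_pi_lambda _ fun _ => ?_,
      {x | x 0 = true} ×ˢ B, ?_, ?_⟩
    · refine measurable_to_bool ?_
      have : (fun ω => decide (ω ∈ A)) ⁻¹' {true} = A := by ext; simp
      rw [this]
      exact hA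
    · refine MeasurableSet.prod ?_ hB
      exact (measurable_pi_apply (X := fun _ : ℕ => Bool) 0) (measurableSet_singleton true)
    · ext; simp
  | compl G hG ih =>
    obtain ⟨f, hf, G', hG', rfl⟩ := ih
    exact ⟨f, hf, G'ᶜ, hG'.compl, rfl⟩
  | iUnion G _ hG ih =>
    choose f hf G' hG' he using ih
    -- Countably many Cantor-valued maps are interleaved into one by the pairing function.
    refine ⟨fun ω n => f n.unpair.1 ω n.unpair.2, measurable_pi_lambda _ fun n =>
      (measurable_pi_apply _).comp (hf n.unpair.1),
      ⋃ n, Prod.map (fun (x : ℕ → Bool) i => x (Nat.pair n i)) id ⁻¹' G' n,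
      MeasurableSet.iUnion fun n => ?_, ?_⟩
    · exact (Measurable.prodMap (measurable_pi_lambda _ fun i => measurable_pi_apply _)
        measurable_id) (hG' n)
    · ext ⟨ω, x⟩
      simp only [Set.mem_iUnion, Set.mem_preimage]
      refine exists_congr fun n => ?_
      rw [he n]
      simp

/-- A measurable selection theorem: a random set that is non-empty with positive outer probability
has a measurable selection on an event of positive probability. -/
theorem IsRandomSet.exists_partial_selection {Ω E : Type*} [NormedAddCommGroup E]
    [CompleteSpace E] [TopologicalSpace.SeparableSpace E] [MeasurableSpace E] [BorelSpace E]
    {H mΩ : MeasurableSpace Ω} (hH : H ≤ mΩ) {μ : Measure Ω} [IsFiniteMeasure μ] {Z : Ω → Set E}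
    (hZ : IsRandomSet H Z) (hpos : μ {ω | (Z ω).Nonempty} ≠ 0) :
    ∃ D, MeasurableSet[H] D ∧ μ D ≠ 0 ∧ ∃ ξ : Ω → E, Measurable[H] ξ ∧ ∀ ω ∈ D, ξ ω ∈ Z ω := by
  have : SecondCountableTopology E := UniformSpace.secondCountable_of_separable E
  obtain ⟨f, hf, G, hG, hfG⟩ := exists_preimage_of_measurableSet_prod (mΩ := H) hZ
  have hfm : Measurable f := hf.mono hH le_rfl
  have hZ_iff : ∀ ω x, x ∈ Z ω ↔ (f ω, x) ∈ G := fun ω x =>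
    (Set.ext_iff.1 hfG (ω, x))
  have : PolishSpace Bool := inferInstance
  have : PolishSpace (ℕ → Bool) := inferInstance
  have hGa := hG.analyticSet
  rw [AnalyticSet] at hGa
  obtain rfl | ⟨g, hg, rfl⟩ := hGa
  · simp [Set.Nonempty, hZ_iff] at hpos
  let p : (ℕ → ℕ) → ℕ → Bool := fun x => (g x).1
  have hp : Continuous p := continuous_fst.comp hg
  have hrange : μ.map f (Set.range p) ≠ 0 := by
    -- The range of `p` need not be Borel; `Measure.le_map_apply` bounds the outer measure of its
    -- preimage.
    refine fun h0 => hpos (measure_mono_null ?_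
      (le_antisymm ((Measure.le_map_apply hfm.aemeasurable _).trans h0.le) bot_le))
    rintro ω ⟨x, hx⟩
    obtain ⟨y, hy⟩ := (hZ_iff ω x).1 hx
    exact ⟨y, congrArg Prod.fst hy⟩
  obtain ⟨K, hK, hK0⟩ := exists_isCompact_lt_measure_image (μ.map f) hp hrange
  obtain ⟨s, hs, hsK⟩ := exists_measurable_section_of_isCompact hp hK
  have hpK : MeasurableSet (p '' K) := (hK.image hp).isClosed.measurableSet
  refine ⟨f ⁻¹' (p '' K), hf hpK, ?_, fun ω => (g (s (f ω))).2,
    (measurable_snd.comp hg.measurable).comp (hs.comp hf), fun ω hω => ?_⟩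
  · rwa [← Measure.map_apply hfm hpK]
  · rw [hZ_iff]
    exact ⟨s (f ω), Prod.ext (hsK _ hω).2 rfl⟩

end Selection

/-! ### Exhaustion, measurable indices and countable bases -/

section Exhaustion

/-- A non-empty family of measurable sets that is stable under countable unions has a member that
is largest up to null sets. -/
theorem exists_ae_largest {Ω : Type*} [MeasurableSpace Ω] (μ : Measure Ω) [IsFiniteMeasure μ]
    {P : Set Ω → Prop} (hm : ∀ D, P D → MeasurableSet D) (hne : ∃ D, P D)
    (hU : ∀ D : ℕ → Set Ω, (∀ n, P (D n)) → P (⋃ n, D n)) :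
    ∃ D, P D ∧ ∀ D', P D' → ∀ᵐ ω ∂μ, ω ∈ D' → ω ∈ D := by
  have hS : (μ '' {D | P D}).Nonempty := Set.Nonempty.image _ hne
  obtain ⟨u, -, hu, huS⟩ := exists_seq_tendsto_sSup hS (OrderTop.bddAbove _)
  choose D hD hDu using huS
  refine ⟨⋃ n, D n, hU D hD, fun D' hD' => ?_⟩
  -- The union of a maximising sequence attains the supremum, so adjoining `D'` cannot add mass.
  have hle : ∀ A, P A → μ A ≤ μ (⋃ n, D n) := fun A hA =>
    (le_sSup (Set.mem_image_of_mem μ (show A ∈ {D | P D} from hA))).trans (le_of_tendsto' hu fun n =>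
      (hDu n).ge.trans (measure_mono (Set.subset_iUnion D n)))
  have hPU : P (D' ∪ ⋃ n, D n) := by
    have h : D' ∪ ⋃ n, D n = ⋃ n : ℕ, Nat.casesOn n D' D := by
      ext x
      simp only [Set.mem_union, Set.mem_iUnion]
      constructor
      · rintro (h | ⟨n, h⟩)
        exacts [⟨0, h⟩, ⟨n + 1, h⟩]
      · rintro ⟨_ | n, h⟩
        exacts [Or.inl h, Or.inr ⟨n, h⟩]
    rw [h]
    refine hU _ fun n => ?_
    cases n with
    | zero => exact hD'
    | succ n => exact hD n
  have h0 : μ (D' \ ⋃ n, D n) = 0 := by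
    rw [← Set.union_sdiff_right, measure_sdiff Set.subset_union_right
      (hm _ (hU D hD)).nullMeasurableSet (measure_ne_top _ _)]
    exact tsub_eq_zero_of_le (hle _ hPU)
  filter_upwards [measure_eq_zero_iff_ae_notMem.1 h0] with ω hω hωD'
  by_contra h
  exact hω ⟨hωD', h⟩

/-- A measurable choice of an index `n` with `ω ∈ D n`, for `ω` in the union of the sets `D n`. -/
theorem exists_measurable_index {Ω : Type*} {_ : MeasurableSpace Ω} {D : ℕ → Set Ω}
    (hD : ∀ n, MeasurableSet (D n)) :
    ∃ j : Ω → ℕ, Measurable j ∧ ∀ ω ∈ ⋃ n, D n, ω ∈ D (j ω) := by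
  classical
  let p : Ω → ℕ → Prop := fun ω n => ω ∈ D n ∨ ω ∉ ⋃ n, D n
  have hp : ∀ ω, ∃ n, p ω n := by
    intro ω
    by_cases h : ω ∈ ⋃ n, D n
    · obtain ⟨n, hn⟩ := Set.mem_iUnion.1 h
      exact ⟨n, Or.inl hn⟩
    · exact ⟨0, Or.inr h⟩
  refine ⟨fun ω => Nat.find (hp ω), measurable_find hp fun n =>
    (hD n).union (MeasurableSet.iUnion hD).compl, fun ω hω => ?_⟩
  exact (Nat.find_spec (hp ω)).resolve_right fun h => h hω

theorem measurable_apply_index {Ω E : Type*} {_ : MeasurableSpace Ω} [MeasurableSpace E] {j : Ω → ℕ}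
    (hj : Measurable j) {f : ℕ → Ω → E} (hf : ∀ n, Measurable (f n)) :
    Measurable fun ω => f (j ω) ω :=
  (measurable_from_prod_countable_right (f := fun q : ℕ × Ω => f q.1 q.2) hf).comp
    (hj.prodMk measurable_id)

theorem exists_seq_basis (E : Type*) [TopologicalSpace E] [SecondCountableTopology E]
    [Nonempty E] : ∃ B : ℕ → Set E, (∀ k, IsOpen (B k)) ∧
      ∀ x U, IsOpen U → x ∈ U → ∃ k, x ∈ B k ∧ B k ⊆ U := by
  have hb := TopologicalSpace.isBasis_countableBasis E
  have hne : (TopologicalSpace.countableBasis E).Nonempty := by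
    obtain ⟨x⟩ := ‹Nonempty E›
    obtain ⟨v, hv, -⟩ := hb.exists_subset_of_mem_open (Set.mem_univ x) isOpen_univ
    exact ⟨v, hv⟩
  obtain ⟨B, hB⟩ := (TopologicalSpace.countable_countableBasis E).exists_eq_range hne
  refine ⟨B, fun k => hb.isOpen (hB ▸ Set.mem_range_self k), fun x U hU hx => ?_⟩
  obtain ⟨v, hv, hxv, hvU⟩ := hb.exists_subset_of_mem_open hx hU
  rw [hB] at hv
  obtain ⟨k, rfl⟩ := hv
  exact ⟨k, hxv, hvU⟩

theorem mem_closure_of_forall_mem_basis {E : Type*} [TopologicalSpace E] {B : ℕ → Set E}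
    (hB : ∀ x U, IsOpen U → x ∈ U → ∃ k, x ∈ B k ∧ B k ⊆ U) {x : E} {s : Set E}
    (h : ∀ k, x ∈ B k → (B k ∩ s).Nonempty) : x ∈ closure s := by
  refine mem_closure_iff.2 fun U hU hxU => ?_
  obtain ⟨k, hxk, hkU⟩ := hB x U hU hxU
  exact (h k hxk).mono (Set.inter_subset_inter_left _ hkU)

end Exhaustion

/-! ### Elementary random sets -/

section RandomSet

variable {Ω E : Type*} [MeasurableSpace E] {H : MeasurableSpace Ω}

theorem IsRandomSet.inter {Z W : Ω → Set E} (hZ : IsRandomSet H Z) (hW : IsRandomSet H W) :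
    IsRandomSet H fun ω => Z ω ∩ W ω :=
  MeasurableSet.inter hZ hW

theorem isRandomSet_const {B : Set E} (hB : MeasurableSet B) : IsRandomSet H fun _ => B :=
  measurable_snd hB

theorem isRandomSet_restrict {D : Set Ω} (hD : MeasurableSet[H] D) :
    IsRandomSet H fun ω => {_x : E | ω ∈ D} :=
  measurable_fst hD

end RandomSet

/-! ### Partial selections, the core and the convex hull -/

section PartialSelections

variable {Ω E : Type*} [NormedAddCommGroup E] [MeasurableSpace E]

/-- `ξ` is an `H`-measurable selection of `W` over the event `D`, almost surely. -/
structure IsPartialSelection (H : MeasurableSpace Ω) [mΩ : MeasurableSpace Ω] (μ : Measure Ω)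
    (W : Ω → Set E) (D : Set Ω) (ξ : Ω → E) : Prop where
  measurableSet : MeasurableSet[H] D
  measurable : Measurable[H] ξ
  ae_mem : ∀ᵐ ω ∂μ, ω ∈ D → ξ ω ∈ W ω

variable {H : MeasurableSpace Ω}

/-- The closure of a countable family of partially defined random elements is a random set. -/
theorem isRandomSet_closure [SecondCountableTopology E] [BorelSpace E] {D : ℕ → Set Ω}
    (hD : ∀ k, MeasurableSet[H] (D k)) {ξ : ℕ → Ω → E} (hξ : ∀ k, Measurable[H] (ξ k)) :
    IsRandomSet H fun ω => closure {x | ∃ k, ω ∈ D k ∧ ξ k ω = x} := by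
  let _ : MeasurableSpace Ω := H
  have h : {p : Ω × E | p.2 ∈ closure {x | ∃ k, p.1 ∈ D k ∧ ξ k p.1 = x}} =
      ⋂ m : ℕ, ⋃ k, (Prod.fst ⁻¹' D k) ∩ {p : Ω × E | dist p.2 (ξ k p.1) < 1 / ((m : ℝ) + 1)} := by
    ext ⟨ω, x⟩
    simp only [Set.mem_ofPred_eq, Metric.mem_closure_iff, Set.mem_iInter, Set.mem_iUnion,
      Set.mem_inter_iff, Set.mem_preimage]
    constructor
    · intro h m
      obtain ⟨_, ⟨k, hk, rfl⟩, hd⟩ := h _ (Nat.one_div_pos_of_nat (n := m))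
      exact ⟨k, hk, hd⟩
    · intro h ε hε
      obtain ⟨m, hm⟩ := exists_nat_one_div_lt hε
      obtain ⟨k, hk, hd⟩ := h m
      exact ⟨_, ⟨k, hk, rfl⟩, hd.trans hm⟩
  refine (congrArg MeasurableSet h).mpr (.iInter fun m => .iUnion fun k => ?_)
  exact (measurable_fst (hD k)).inter
    (measurableSet_lt (measurable_snd.dist ((hξ k).comp measurable_fst)) measurable_const)

variable [mΩ : MeasurableSpace Ω] {μ : Measure Ω} [IsFiniteMeasure μ]

/-- Partial selections paste along a measurable index, so their domains are stable under countable
unions and exhaustion applies. -/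
theorem exists_largest_partialSelection (hH : H ≤ mΩ) (μ : Measure Ω) [IsFiniteMeasure μ]
    (W : Ω → Set E) :
    ∃ D ξ, IsPartialSelection H μ W D ξ ∧
      ∀ D' ξ', IsPartialSelection H μ W D' ξ' → ∀ᵐ ω ∂μ, ω ∈ D' → ω ∈ D := by
  obtain ⟨D, ⟨ξ, hξ⟩, hmax⟩ := exists_ae_largest μ (P := fun D => ∃ ξ, IsPartialSelection H μ W D ξ)
    (fun D hD => hH _ hD.choose_spec.measurableSet)
    ⟨∅, fun _ => 0, @MeasurableSet.empty _ H, @measurable_const _ _ _ H _, by simp⟩ (by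
      intro D hD
      choose ξ hξ using hD
      obtain ⟨j, hj, hjD⟩ := exists_measurable_index fun n => (hξ n).measurableSet
      refine ⟨fun ω => ξ (j ω) ω, .iUnion fun n => (hξ n).measurableSet,
        measurable_apply_index hj fun n => (hξ n).measurable, ?_⟩
      filter_upwards [ae_all_iff.2 fun n => (hξ n).ae_mem] with ω hω h
      exact hω _ (hjD ω h))
  exact ⟨D, ξ, hξ, fun D' ξ' h => hmax D' ⟨ξ', h⟩⟩

variable [CompleteSpace E] [TopologicalSpace.SeparableSpace E] [BorelSpace E]

/-- Almost sure inclusion of random sets can be tested on partial selections. -/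
theorem IsRandomSet.ae_subset (hH : H ≤ mΩ) {Z W : Ω → Set E} (hZ : IsRandomSet H Z)
    (hW : IsRandomSet H W)
    (h : ∀ D ζ, IsPartialSelection H μ Z D ζ → ∀ᵐ ω ∂μ, ω ∈ D → ζ ω ∈ W ω) :
    ∀ᵐ ω ∂μ, Z ω ⊆ W ω := by
  have hZW : IsRandomSet H fun ω => Z ω \ W ω := MeasurableSet.diff hZ hW
  by_contra hcon
  have hpos : μ {ω | (Z ω \ W ω).Nonempty} ≠ 0 := by
    intro h0
    refine hcon ?_
    filter_upwards [measure_eq_zero_iff_ae_notMem.1 h0] with ω hω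
    exact Set.sdiff_eq_empty.1 (Set.not_nonempty_iff_eq_empty.1 hω)
  obtain ⟨D, hD, hD0, ζ, hζ, hmem⟩ := hZW.exists_partial_selection hH hpos
  refine hD0 (measure_eq_zero_iff_ae_notMem.2 ?_)
  filter_upwards [h D ζ ⟨hD, hζ, ae_of_all _ fun ω hω => (hmem ω hω).1⟩] with ω hω hωD
  exact (hmem ω hωD).2 (hω hωD)

/-- Up to null sets, the event that a random set is non-empty is measurable. -/
theorem IsRandomSet.exists_measurableSet_nonempty (hH : H ≤ mΩ) {Z : Ω → Set E}
    (hZ : IsRandomSet H Z) :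
    ∃ D, MeasurableSet[H] D ∧ ∀ᵐ ω ∂μ, ω ∈ D ↔ (Z ω).Nonempty := by
  obtain ⟨D, ξ, hξ, hmax⟩ := exists_largest_partialSelection hH μ Z
  refine ⟨D, hξ.measurableSet, ?_⟩
  have hZ' : IsRandomSet H fun ω => Z ω ∩ {_x | ω ∈ Dᶜ} :=
    hZ.inter (isRandomSet_restrict hξ.measurableSet.compl)
  have hsub := hZ'.ae_subset (μ := μ) hH (W := fun _ => ∅)
    (isRandomSet_const MeasurableSet.empty) (by
    intro D' ζ hζ
    filter_upwards [hζ.ae_mem, hmax D' ζ ⟨hζ.measurableSet, hζ.measurable,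
      hζ.ae_mem.mono fun ω h hω => (h hω).1⟩] with ω h1 h2 hω
    exact ((h1 hω).2 (h2 hω)).elim)
  filter_upwards [hξ.ae_mem, hsub] with ω h1 h2
  refine ⟨fun h => ⟨_, h1 h⟩, fun ⟨x, hx⟩ => ?_⟩
  by_contra h
  exact h2 ⟨hx, h⟩

/-- The conditional core exists. -/
theorem exists_isCondCore (hH : H ≤ mΩ) {X : Ω → Set E} (hX : ∀ᵐ ω ∂μ, IsClosed (X ω)) :
    ∃ C, IsCondCore H μ X C := by
  have : SecondCountableTopology E := UniformSpace.secondCountable_of_separable E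
  obtain ⟨B, hBo, hB⟩ := exists_seq_basis E
  choose D ξ hξ hmax using fun k => exists_largest_partialSelection hH μ fun ω => X ω ∩ B k
  have hC : IsRandomSet H fun ω => closure {x | ∃ k, ω ∈ D k ∧ ξ k ω = x} :=
    isRandomSet_closure (fun k => (hξ k).measurableSet) fun k => (hξ k).measurable
  refine ⟨_, hC, ?_, fun Z hZ hZX => hZ.ae_subset hH hC fun D' ζ hζ => ?_⟩
  · filter_upwards [hX, ae_all_iff.2 fun k => (hξ k).ae_mem] with ω hcl hω
    refine closure_minimal ?_ hcl
    rintro _ ⟨k, hk, rfl⟩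
    exact (hω k hk).1
  -- Where `ζ` visits `B k` it is itself a partial selection of `X ∩ B k`, so maximality makes `ξ k`
  -- available there.
  · have key : ∀ k, ∀ᵐ ω ∂μ, ω ∈ D' ∩ ζ ⁻¹' B k → ω ∈ D k := by
      refine fun k => hmax k _ ζ ⟨hζ.measurableSet.inter (hζ.measurable (hBo k).measurableSet),
        hζ.measurable, ?_⟩
      filter_upwards [hζ.ae_mem, hZX] with ω h1 h2 h
      exact ⟨h2 (h1 h.1), h.2⟩
    filter_upwards [ae_all_iff.2 key, ae_all_iff.2 fun k => (hξ k).ae_mem] with ω h1 h2 h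
    refine mem_closure_of_forall_mem_basis hB fun k hk => ?_
    have hDk := h1 k ⟨h, hk⟩
    exact ⟨ξ k ω, (h2 k hDk).2, k, hDk, rfl⟩

/-- The conditional convex hull exists. -/
theorem exists_isCondConvexHull [NormedSpace ℝ E] (hH : H ≤ mΩ) (μ : Measure Ω)
    [IsFiniteMeasure μ] (X : Ω → Set E) : ∃ M, IsCondConvexHull H μ X M := by
  have : SecondCountableTopology E := UniformSpace.secondCountable_of_separable E
  obtain ⟨B, hBo, hB⟩ := exists_seq_basis E
  let Q : (Ω → Set E) → Prop := fun Z => IsRandomClosedSet H μ Z ∧ (∀ᵐ ω ∂μ, Convex ℝ (Z ω)) ∧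
    ∀ᵐ ω ∂μ, X ω ⊆ Z ω
  have hQ : ∀ Z : ℕ → Ω → Set E, (∀ n, Q (Z n)) → Q fun ω => ⋂ n, Z n ω := by
    intro Z hZ
    refine ⟨⟨?_, ?_⟩, ?_, ?_⟩
    · have : {p : Ω × E | p.2 ∈ ⋂ n, Z n p.1} = ⋂ n, {p : Ω × E | p.2 ∈ Z n p.1} := by
        ext; simp
      refine (congrArg (MeasurableSet[H.prod _]) this).mpr (.iInter fun n => (hZ n).1.1)
    · filter_upwards [ae_all_iff.2 fun n => (hZ n).1.2] with ω h using isClosed_iInter h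
    · filter_upwards [ae_all_iff.2 fun n => (hZ n).2.1] with ω h using convex_iInter h
    · filter_upwards [ae_all_iff.2 fun n => (hZ n).2.2] with ω h using Set.subset_iInter h
  have hQuniv : Q fun _ => Set.univ :=
    ⟨⟨MeasurableSet.univ, ae_of_all _ fun _ => isClosed_univ⟩, ae_of_all _ fun _ => convex_univ,
      ae_of_all _ fun _ => Set.subset_univ _⟩
  have hmax : ∀ k, ∃ D, (MeasurableSet[H] D ∧ ∃ Z, Q Z ∧ ∀ᵐ ω ∂μ, ω ∈ D → Disjoint (Z ω) (B k)) ∧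
      ∀ D', (MeasurableSet[H] D' ∧ ∃ Z, Q Z ∧ ∀ᵐ ω ∂μ, ω ∈ D' → Disjoint (Z ω) (B k)) →
        ∀ᵐ ω ∂μ, ω ∈ D' → ω ∈ D := by
    refine fun k => exists_ae_largest μ (fun D hD => hH _ hD.1)
      ⟨∅, @MeasurableSet.empty _ H, _, hQuniv, by simp⟩ fun D hD => ?_
    choose hDm Z hZ hZD using hD
    refine ⟨.iUnion hDm, _, hQ Z hZ, ?_⟩
    filter_upwards [ae_all_iff.2 hZD] with ω h hω
    obtain ⟨n, hn⟩ := Set.mem_iUnion.1 hω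
    exact (h n hn).mono_left (Set.iInter_subset _ n)
  choose D hD hmax using hmax
  choose hDm Z hZ hZD using hD
  obtain ⟨h1, h2, h3⟩ := hQ Z hZ
  refine ⟨_, h1, h2, h3, fun W hW hWc hXW => ?_⟩
  -- The event that a competitor `W` misses `B k` agrees with an `H`-measurable one up to a null
  -- set, so maximality of `D k` covers it.
  have key : ∀ k, ∀ᵐ ω ∂μ, Disjoint (W ω) (B k) → ω ∈ D k := by
    intro k
    have hWB : IsRandomSet H fun ω => W ω ∩ B k :=
    hW.1.inter (isRandomSet_const (hBo k).measurableSet)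
    obtain ⟨N, hN, hNW⟩ := hWB.exists_measurableSet_nonempty (μ := μ) hH
    filter_upwards [hNW, hmax k Nᶜ ⟨hN.compl, W, ⟨hW, hWc, hXW⟩, by
      filter_upwards [hNW] with ω h hω
      rw [Set.disjoint_iff_inter_eq_empty]
      exact Set.not_nonempty_iff_eq_empty.1 fun hn => hω (h.2 hn)⟩] with ω h4 h5 hdis
    refine h5 fun hωN => ?_
    exact Set.not_nonempty_iff_eq_empty.2 (Set.disjoint_iff_inter_eq_empty.1 hdis) (h4.1 hωN)
  filter_upwards [hW.2, ae_all_iff.2 key, ae_all_iff.2 hZD] with ω hcl h4 h5 x hx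
  by_contra hxW
  obtain ⟨k, hxk, hk⟩ := hB x _ hcl.isOpen_compl hxW
  exact Set.disjoint_left.1 (h5 k (h4 k (Set.disjoint_left.2 fun y hy hyk => hk hyk hy)))
    (Set.mem_iInter.1 hx k) hxk

end PartialSelections

/-! ### Conditional expectation as a mean of the conditional law -/

section CondDistrib

open ProbabilityTheory

/-- On an event on which `ξ` is integrable, the conditional expectation of `ξ` given `T` belongs to
a closed convex set depending measurably on `T` whenever `ξ` does. -/
theorem condExp_indicator_mem_of_convex {α β E : Type*} [NormedAddCommGroup E] [NormedSpace ℝ E]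
    [CompleteSpace E] [TopologicalSpace.SeparableSpace E] [MeasurableSpace E] [BorelSpace E]
    {mα : MeasurableSpace α} {mβ : MeasurableSpace β} {μ : Measure α} [IsFiniteMeasure μ]
    {T : α → β} (hT : Measurable T) {ξ : α → E} (hξ : Measurable ξ) {M : β → Set E}
    (hM : IsRandomSet mβ M) (hcl : ∀ᵐ a ∂μ, IsClosed (M (T a)))
    (hconv : ∀ᵐ a ∂μ, Convex ℝ (M (T a))) (hmem : ∀ᵐ a ∂μ, ξ a ∈ M (T a)) {A : Set β}
    (hA : MeasurableSet A) (hint : Integrable ((T ⁻¹' A).indicator ξ) μ) :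
    ∀ᵐ a ∂μ, T a ∈ A → μ[(T ⁻¹' A).indicator ξ | mβ.comap T] a ∈ M (T a) := by
  have : SecondCountableTopology E := UniformSpace.secondCountable_of_separable E
  let f : β × E → E := (Prod.fst ⁻¹' A).indicator Prod.snd
  have hf : StronglyMeasurable f :=
    (measurable_snd.indicator (measurable_fst hA)).stronglyMeasurable
  have hfξ : (fun a => f (T a, ξ a)) = (T ⁻¹' A).indicator ξ := by
    ext a
    by_cases ha : T a ∈ A <;> simp [f, Set.indicator, ha]
  have hint' : Integrable (fun a => f (T a, ξ a)) μ := by rwa [hfξ]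
  have hcond := condExp_prod_ae_eq_integral_condDistrib hT hξ.aemeasurable hf hint'
  rw [hfξ] at hcond
  have hintk := ((integrable_map_measure hf.aestronglyMeasurable
    (hT.prodMk hξ).aemeasurable).2 hint').condDistrib_ae hT.aemeasurable hξ.aemeasurable
  have hM' : MeasurableSet {p : β × E | p.2 ∈ M p.1} := hM
  -- Disintegrating the joint law of `(T, ξ)`, which is carried by the graph of `M`, shows that
  -- almost every conditional law is carried by the fibre.
  have hk : ∀ᵐ a ∂μ, ∀ᵐ x ∂condDistrib ξ T μ (T a), x ∈ M (T a) := by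
    refine ae_of_ae_map (p := fun b => ∀ᵐ x ∂condDistrib ξ T μ b, x ∈ M b) hT.aemeasurable ?_
    rw [← Measure.ae_compProd_iff hM', compProd_map_condDistrib hξ.aemeasurable,
      ae_map_iff (hT.prodMk hξ).aemeasurable hM']
    exact hmem
  filter_upwards [hcl, hconv, hcond, hintk, hk] with a h1 h2 h3 h4 h5 ha
  rw [h3]
  have hfa : (fun x => f (T a, x)) = id := by
    ext x
    simp [f, ha]
  simp only [hfa] at h4 ⊢
  exact h2.integral_mem h1 h5 h4

end CondDistrib

/-! ### Generalised conditional expectation of random elements -/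

section GenCondExp

variable {Ω E : Type*} [NormedAddCommGroup E] [NormedSpace ℝ E] [CompleteSpace E]
  [TopologicalSpace.SeparableSpace E] [MeasurableSpace E] [BorelSpace E]
  {H : MeasurableSpace Ω} [mΩ : MeasurableSpace Ω] {μ : Measure Ω} [IsFiniteMeasure μ]

omit [TopologicalSpace.SeparableSpace E] [BorelSpace E] [IsFiniteMeasure μ] in
theorem isGenCondExp_iff {ξ η : Ω → E} :
    IsGenCondExp H μ ξ η ↔ Measurable[H] η ∧ ∃ A, IsIntegrabilityPartition H μ ξ A ∧
      ∀ i, ∀ᵐ ω ∂μ, ω ∈ A i → η ω = (μ[(A i).indicator ξ | H]) ω := by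
  refine and_congr_right fun _ => exists_congr fun A => and_congr_right fun hA => ?_
  have hsum : ∀ i, ∀ ω ∈ A i, ∑' i, (A i).indicator (μ[(A i).indicator ξ | H]) ω =
      (μ[(A i).indicator ξ | H]) ω := by
    intro i ω hi
    rw [tsum_eq_single i fun k hk => Set.indicator_of_notMem
      (fun h => Set.disjoint_left.1 (hA.disjoint hk) h hi) _, Set.indicator_of_mem hi]
  rw [← ae_all_iff]
  refine eventually_congr (ae_of_all _ fun ω => ⟨fun h i hi => h.trans (hsum i ω hi), fun h => ?_⟩)
  obtain ⟨i, hi⟩ := Set.mem_iUnion.1 (hA.iUnion_eq.symm ▸ Set.mem_univ ω : ω ∈ ⋃ i, A i)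
  exact (h i hi).trans (hsum i ω hi).symm

-- The level sets of `j` refine the given partitions into one countable `H`-measurable partition,
-- and conditional expectation commutes with `H`-measurable indicators.
omit [TopologicalSpace.SeparableSpace E] [BorelSpace E] [IsFiniteMeasure μ] in
theorem IsGenCondExp.paste (hH : H ≤ mΩ) {ξ η : ℕ → Ω → E} (h : ∀ n, IsGenCondExp H μ (ξ n) (η n))
    {j : Ω → ℕ} (hj : Measurable[H] j) :
    IsGenCondExp H μ (fun ω => ξ (j ω) ω) fun ω => η (j ω) ω := by
  simp only [isGenCondExp_iff] at h ⊢
  choose hη A hA hηA using h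
  have hjm : ∀ n, MeasurableSet[H] (j ⁻¹' {n}) := fun n => hj (measurableSet_singleton n)
  have hind : ∀ n i, (j ⁻¹' {n} ∩ A n i).indicator (fun ω => ξ (j ω) ω) =
      (j ⁻¹' {n}).indicator ((A n i).indicator (ξ n)) := by
    intro n i
    rw [← Set.indicator_indicator]
    ext ω
    by_cases hω : j ω = n
    · simp [Set.indicator, hω]
    · simp [Set.indicator, hω]
  refine ⟨measurable_apply_index hj hη, fun m => j ⁻¹' {m.unpair.1} ∩ A m.unpair.1 m.unpair.2,
    ⟨fun m => (hjm _).inter ((hA _).measurableSet _), ?_, ?_, fun m => ?_⟩, fun m => ?_⟩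
  · refine fun m m' hmm => Set.disjoint_left.2 fun ω hω hω' => hmm ?_
    have h1 : m.unpair.1 = m'.unpair.1 := hω.1.symm.trans hω'.1
    have h2 : m.unpair.2 = m'.unpair.2 := by
      by_contra hne
      refine Set.disjoint_left.1 ((hA m.unpair.1).disjoint hne) hω.2 ?_
      rw [h1]
      exact hω'.2
    rw [← Nat.pair_unpair m, ← Nat.pair_unpair m', h1, h2]
  · refine Set.eq_univ_of_forall fun ω => ?_
    obtain ⟨i, hi⟩ := Set.mem_iUnion.1
      ((hA (j ω)).iUnion_eq.symm ▸ Set.mem_univ ω : ω ∈ ⋃ i, A (j ω) i)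
    exact Set.mem_iUnion.2 ⟨Nat.pair (j ω) i, by simpa using hi⟩
  · rw [hind]
    exact ((hA _).integrable _).indicator (hH _ (hjm _))
  · rw [hind]
    filter_upwards [hηA m.unpair.1 m.unpair.2,
      condExp_indicator ((hA m.unpair.1).integrable m.unpair.2) (hjm m.unpair.1)] with ω h1 h2 hω
    have hjω : j ω = m.unpair.1 := hω.1
    rw [h2, Set.indicator_of_mem hω.1, hjω]
    exact h1 hω.2

/-- Partitioning by the integer part of the norm makes `ζ` bounded on each block, hence integrable
there. -/
theorem isGenCondExp_self (hH : H ≤ mΩ) {ζ : Ω → E} (hζ : Measurable[H] ζ) :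
    IsGenCondExp H μ ζ ζ := by
  have : SecondCountableTopology E := UniformSpace.secondCountable_of_separable E
  let f : Ω → ℕ := fun ω => ⌊‖ζ ω‖⌋₊
  have hA : ∀ i : ℕ, MeasurableSet[H] (f ⁻¹' {i}) := fun i =>
    (Nat.measurable_floor.comp (measurable_norm.comp hζ)) (measurableSet_singleton i)
  have hind : ∀ i : ℕ, Measurable[H] ((f ⁻¹' {i}).indicator ζ) := fun i =>
    hζ.indicator (hA i)
  have hint : ∀ i : ℕ, Integrable ((f ⁻¹' {i}).indicator ζ) μ := by
    intro i
    refine Integrable.of_bound ((hind i).mono hH le_rfl).aestronglyMeasurable ((i : ℝ) + 1)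
      (ae_of_all _ fun ω => ?_)
    by_cases hω : ⌊‖ζ ω‖⌋₊ = i
    · rw [Set.indicator_of_mem (show ω ∈ f ⁻¹' {i} from hω), ← hω]
      exact (Nat.lt_floor_add_one _).le
    · rw [Set.indicator_of_notMem (show ω ∉ f ⁻¹' {i} from hω), norm_zero]
      positivity
  refine isGenCondExp_iff.2 ⟨hζ, fun i => f ⁻¹' {i}, ⟨hA, fun a b hab => Set.disjoint_left.2 fun ω h h' =>
    hab (h.symm.trans h'), Set.eq_univ_of_forall fun ω => Set.mem_iUnion.2 ⟨_, rfl⟩, hint⟩,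
    fun i => ae_of_all _ fun ω hω => ?_⟩
  rw [condExp_of_stronglyMeasurable hH (hind i).stronglyMeasurable (hint i),
    Set.indicator_of_mem hω]

omit [TopologicalSpace.SeparableSpace E] [IsFiniteMeasure μ] in
theorem IsIntegrabilityPartition.exists_isGenCondExp {ξ : Ω → E} {A : ℕ → Set Ω}
    (hA : IsIntegrabilityPartition H μ ξ A) : ∃ η, IsGenCondExp H μ ξ η := by
  obtain ⟨j, hj, hjA⟩ := exists_measurable_index hA.measurableSet
  refine ⟨fun ω => (μ[(A (j ω)).indicator ξ | H]) ω, isGenCondExp_iff.2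
    ⟨measurable_apply_index (f := fun n => μ[(A n).indicator ξ | H]) hj
      fun n => stronglyMeasurable_condExp.measurable, A, hA,
      fun i => ae_of_all _ fun ω hω => ?_⟩⟩
  have : j ω = i := by
    by_contra hne
    exact Set.disjoint_left.1 (hA.disjoint hne) (hjA ω (Set.mem_iUnion.2 ⟨i, hω⟩)) hω
  rw [this]

/-- Generalised conditional expectations stay in measurable closed convex sets. -/
theorem IsGenCondExp.ae_mem_of_convex (hH : H ≤ mΩ) {ξ η : Ω → E} (h : IsGenCondExp H μ ξ η)
    (hξ : Measurable ξ) {M : Ω → Set E} (hM : IsRandomClosedSet H μ M)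
    (hconv : ∀ᵐ ω ∂μ, Convex ℝ (M ω)) (hmem : ∀ᵐ ω ∂μ, ξ ω ∈ M ω) : ∀ᵐ ω ∂μ, η ω ∈ M ω := by
  obtain ⟨-, A, hA, hη⟩ := isGenCondExp_iff.1 h
  have key : ∀ i, ∀ᵐ ω ∂μ, ω ∈ A i → (μ[(A i).indicator ξ | H]) ω ∈ M ω := by
    intro i
    -- Conditioning on `H` is conditioning on the identity map from `mΩ` to `H`.
    have := condExp_indicator_mem_of_convex (mβ := H) (T := id) (measurable_id'' hH) hξ hM.1 hM.2
      hconv hmem (hA.measurableSet i) (hA.integrable i)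
    rwa [MeasurableSpace.comap_id] at this
  filter_upwards [ae_all_iff.2 hη, ae_all_iff.2 key] with ω h1 h2
  obtain ⟨i, hi⟩ := Set.mem_iUnion.1 (hA.iUnion_eq.symm ▸ Set.mem_univ ω : ω ∈ ⋃ i, A i)
  rw [h1 i hi]
  exact h2 i hi

end GenCondExp

/-! ### Decomposable families and closure in probability -/

section Decomposable

theorem measurableSet_dist_lt {Ω E : Type*} {_ : MeasurableSpace Ω} [PseudoMetricSpace E]
    [SecondCountableTopology E] [MeasurableSpace E] [OpensMeasurableSpace E] {f g : Ω → E}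
    (hf : Measurable f) (hg : Measurable g) (ε : ℝ) : MeasurableSet {ω | dist (f ω) (g ω) < ε} :=
  measurableSet_lt (hf.dist hg) measurable_const

variable {Ω E : Type*} [NormedAddCommGroup E] [MeasurableSpace E] [BorelSpace E]
  {H : MeasurableSpace Ω} [mΩ : MeasurableSpace Ω] {μ : Measure Ω} [IsFiniteMeasure μ]

omit [BorelSpace E] [IsFiniteMeasure μ] in
/-- Membership in a random closed set passes to limits in probability. -/
theorem ae_mem_of_mem_closureInProbability {Ξ : Set (Ω → E)} {M : Ω → Set E}
    (hcl : ∀ᵐ ω ∂μ, IsClosed (M ω)) (hΞ : ∀ η ∈ Ξ, ∀ᵐ ω ∂μ, η ω ∈ M ω) {η : Ω → E}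
    (hη : η ∈ closureInProbability H μ Ξ) : ∀ᵐ ω ∂μ, η ω ∈ M ω := by
  obtain ⟨-, u, hu, hlim⟩ := hη
  obtain ⟨φ, -, hφ⟩ := hlim.exists_seq_tendsto_ae
  filter_upwards [hcl, hφ, ae_all_iff.2 fun n => hΞ _ (hu n)] with ω h1 h2 h3
  exact h1.mem_of_tendsto h2 (Eventually.of_forall fun n => h3 _)

omit [BorelSpace E] [IsFiniteMeasure μ] in
theorem subset_closureInProbability {Ξ : Set (Ω → E)} (hm : ∀ η ∈ Ξ, Measurable[H] η) :
    Ξ ⊆ closureInProbability H μ Ξ := fun η hη =>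
  ⟨hm η hη, fun _ => η, fun _ => hη, tendstoInMeasure_of_ne_top fun ε hε _ => by
    simp [hε.not_ge]⟩

/-- The closure in probability of a countably decomposable family of random elements consists of
the selections of a random closed set. -/
theorem exists_selections_eq_closureInProbability [TopologicalSpace.SeparableSpace E]
    (hH : H ≤ mΩ) {Ξ : Set (Ω → E)}
    (hne : Ξ.Nonempty) (hm : ∀ η ∈ Ξ, Measurable[H] η)
    (hpaste : ∀ η : ℕ → Ω → E, (∀ n, η n ∈ Ξ) → ∀ j : Ω → ℕ, Measurable[H] j →
      (fun ω => η (j ω) ω) ∈ Ξ) :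
    ∃ Y, IsRandomClosedSet H μ Y ∧ selections H μ Y = closureInProbability H μ Ξ := by
  have : SecondCountableTopology E := UniformSpace.secondCountable_of_separable E
  obtain ⟨B, hBo, hB⟩ := exists_seq_basis E
  obtain ⟨η₀, hη₀⟩ := hne
  have hmax : ∀ k, ∃ D, (MeasurableSet[H] D ∧ ∃ η ∈ Ξ, ∀ᵐ ω ∂μ, ω ∈ D → η ω ∈ B k) ∧
      ∀ D', (MeasurableSet[H] D' ∧ ∃ η ∈ Ξ, ∀ᵐ ω ∂μ, ω ∈ D' → η ω ∈ B k) →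
        ∀ᵐ ω ∂μ, ω ∈ D' → ω ∈ D := by
    refine fun k => exists_ae_largest μ (fun D hD => hH _ hD.1)
      ⟨∅, @MeasurableSet.empty _ H, η₀, hη₀, by simp⟩ fun D hD => ?_
    choose hDm η hη hηD using hD
    obtain ⟨j, hj, hjD⟩ := exists_measurable_index hDm
    refine ⟨.iUnion hDm, _, hpaste η hη j hj, ?_⟩
    filter_upwards [ae_all_iff.2 hηD] with ω h hω
    exact h _ (hjD ω hω)
  choose D hD hmax using hmax
  choose hDm η hη hηD using hD
  have hηm := fun k => hm _ (hη k)
  -- The vacuous condition matches the form of `isRandomSet_closure`.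
  let Y : Ω → Set E := fun ω => closure {x | ∃ k : ℕ, ω ∈ Set.univ ∧ η k ω = x}
  have hYcl : ∀ᵐ ω ∂μ, IsClosed (Y ω) := ae_of_all _ fun _ => isClosed_closure
  refine ⟨Y, ⟨isRandomSet_closure (fun _ => .univ) hηm, hYcl⟩, Set.Subset.antisymm ?_ ?_⟩
  · rintro ζ ⟨hζ, hζY⟩
    -- A selection of `Y` is approximated almost surely within `1 / (n + 1)` by pasting the `η k`,
    -- which stays in `Ξ`.
    have hindex : ∀ n : ℕ, ∃ j : Ω → ℕ, Measurable[H] j ∧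
        ∀ᵐ ω ∂μ, dist (η (j ω) ω) (ζ ω) < 1 / ((n : ℝ) + 1) := by
      intro n
      obtain ⟨j, hj, hjd⟩ := exists_measurable_index
        (D := fun k => {ω | dist (η k ω) (ζ ω) < 1 / ((n : ℝ) + 1)}) fun k =>
          measurableSet_dist_lt (hηm k) hζ _
      refine ⟨j, hj, ?_⟩
      filter_upwards [hζY] with ω hω
      obtain ⟨_, ⟨k, -, rfl⟩, hk⟩ := Metric.mem_closure_iff.1 hω _ (Nat.one_div_pos_of_nat (n := n))
      exact hjd ω (Set.mem_iUnion.2 ⟨k, by rwa [dist_comm] at hk⟩)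
    choose j hj hjd using hindex
    refine ⟨hζ, fun n ω => η (j n ω) ω, fun n => hpaste η hη _ (hj n),
      tendstoInMeasure_of_tendsto_ae (fun n => ?_) ?_⟩
    · exact ((measurable_apply_index (hj n) hηm).mono hH le_rfl).aestronglyMeasurable
    · filter_upwards [ae_all_iff.2 hjd] with ω hω
      exact tendsto_iff_dist_tendsto_zero.2 (squeeze_zero (fun _ => dist_nonneg)
        (fun n => (hω n).le) tendsto_one_div_add_atTop_nhds_zero_nat)
  · refine fun ζ hζ => ⟨hζ.1, ae_mem_of_mem_closureInProbability hYcl (fun θ hθ => ?_) hζ⟩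
    -- Wherever a member `θ` of `Ξ` visits `B k`, so does `η k`, by maximality.
    have key : ∀ k, ∀ᵐ ω ∂μ, ω ∈ θ ⁻¹' B k → ω ∈ D k := fun k =>
      hmax k _ ⟨hm θ hθ (hBo k).measurableSet, θ, hθ, ae_of_all _ fun _ h => h⟩
    filter_upwards [ae_all_iff.2 key, ae_all_iff.2 hηD] with ω h1 h2
    exact mem_closure_of_forall_mem_basis hB fun k hk =>
      ⟨η k ω, h2 k (h1 k hk), k, Set.mem_univ ω, rfl⟩

end Decomposable

/-! ### Existence of the conditional expectation set and the two inclusions -/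

section Inclusions

/-- The index function that is `0` on `D` and `1` off `D`. -/
theorem exists_measurable_binary_index {Ω : Type*} {H : MeasurableSpace Ω} {D : Set Ω}
    (hD : MeasurableSet[H] D) :
    ∃ j : Ω → ℕ, Measurable[H] j ∧ (∀ ω ∈ D, j ω = 0) ∧ ∀ ω ∉ D, j ω = 1 := by
  classical
  exact ⟨fun ω => if ω ∈ D then 0 else 1, Measurable.ite hD measurable_const measurable_const,
    fun ω h => if_pos h, fun ω h => if_neg h⟩

variable {Ω E : Type*} [NormedAddCommGroup E] [NormedSpace ℝ E] [CompleteSpace E]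
  [TopologicalSpace.SeparableSpace E] [MeasurableSpace E] [BorelSpace E]
  {H : MeasurableSpace Ω} [mΩ : MeasurableSpace Ω] {μ : Measure Ω} [IsFiniteMeasure μ]
  {X C Y M : Ω → Set E}

/-- The generalised conditional expectation of a random set exists. -/
theorem exists_isGenCondExpSet (hH : H ≤ mΩ) (hint : (condIntegrableSelections H μ X).Nonempty) :
    ∃ Y, IsGenCondExpSet H μ X Y := by
  obtain ⟨ξ₀, hξ₀, A, hA⟩ := hint
  obtain ⟨η₀, hη₀⟩ := hA.exists_isGenCondExp
  obtain ⟨Y, hY, hsel⟩ := exists_selections_eq_closureInProbability (μ := μ) hH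
    (Ξ := {η | ∃ ξ ∈ condIntegrableSelections H μ X, IsGenCondExp H μ ξ η})
    ⟨η₀, ξ₀, ⟨hξ₀, A, hA⟩, hη₀⟩ (fun η ⟨_, _, h⟩ => h.1) (by
      intro η hη j hj
      choose ξ hξ hξη using hη
      have h := IsGenCondExp.paste hH hξη hj
      refine ⟨_, ⟨⟨measurable_apply_index (hj.mono hH le_rfl) fun n => (hξ n).1.1, ?_⟩,
        h.2.imp fun _ => And.left⟩, h⟩
      filter_upwards [ae_all_iff.2 fun n => (hξ n).1.2] with ω hω using hω _)
  exact ⟨Y, hY, hsel⟩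

omit [TopologicalSpace.SeparableSpace E] [BorelSpace E] [IsFiniteMeasure μ] in
theorem IsGenCondExpSet.mem_selections (hY : IsGenCondExpSet H μ X Y) {ξ η : Ω → E}
    (hξ : ξ ∈ selections mΩ μ X) (h : IsGenCondExp H μ ξ η) : η ∈ selections H μ Y := by
  rw [hY.selections_eq]
  refine subset_closureInProbability ?_ ⟨ξ, ⟨hξ, h.2.imp fun _ => And.left⟩, h⟩
  rintro η ⟨_, _, h⟩
  exact h.1

/-- A partial selection `ζ` of `C`, completed by `ξ₀` off its domain, is a selection of `X` whose
generalised conditional expectation is `ζ` on that domain. -/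
theorem IsCondCore.ae_subset_genCondExpSet (hH : H ≤ mΩ)
    (hint : (condIntegrableSelections H μ X).Nonempty) (hC : IsCondCore H μ X C)
    (hY : IsGenCondExpSet H μ X Y) : ∀ᵐ ω ∂μ, C ω ⊆ Y ω := by
  obtain ⟨ξ₀, hξ₀, A, hA⟩ := hint
  obtain ⟨η₀, hη₀⟩ := hA.exists_isGenCondExp
  refine hC.isRandomSet.ae_subset hH hY.isRandomClosedSet.1 fun D ζ hζ => ?_
  obtain ⟨j, hj, hj0, hj1⟩ := exists_measurable_binary_index hζ.measurableSet
  let ξ : ℕ → Ω → E := fun n => n.casesOn ζ fun _ => ξ₀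
  let η : ℕ → Ω → E := fun n => n.casesOn ζ fun _ => η₀
  have hξη : ∀ n, IsGenCondExp H μ (ξ n) (η n)
    | 0 => isGenCondExp_self hH hζ.measurable
    | _ + 1 => hη₀
  have hξm : ∀ n, Measurable (ξ n)
    | 0 => hζ.measurable.mono hH le_rfl
    | _ + 1 => hξ₀.1
  have hsel := hY.mem_selections ⟨measurable_apply_index (hj.mono hH le_rfl) hξm, by
    filter_upwards [hζ.ae_mem, hC.subset, hξ₀.2] with ω h1 h2 h3
    by_cases hω : ω ∈ D
    · rw [hj0 ω hω]
      exact h2 (h1 hω)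
    · rw [hj1 ω hω]
      exact h3⟩ (IsGenCondExp.paste hH hξη hj)
  filter_upwards [hsel.2] with ω h hω
  rw [hj0 ω hω] at h
  exact h

/-- A partial selection of `Y`, completed by `η₀`, is a limit in probability of conditional
expectations, all of which lie in the closed convex `M`. -/
theorem IsGenCondExpSet.ae_subset_condConvexHull (hH : H ≤ mΩ)
    (hint : (condIntegrableSelections H μ X).Nonempty) (hY : IsGenCondExpSet H μ X Y)
    (hM : IsCondConvexHull H μ X M) : ∀ᵐ ω ∂μ, Y ω ⊆ M ω := by
  obtain ⟨ξ₀, hξ₀, A, hA⟩ := hint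
  obtain ⟨η₀, hη₀⟩ := hA.exists_isGenCondExp
  have hη₀Y := hY.mem_selections hξ₀ hη₀
  refine hY.isRandomClosedSet.1.ae_subset hH hM.isRandomClosedSet.1 fun D ζ hζ => ?_
  obtain ⟨j, hj, hj0, hj1⟩ := exists_measurable_binary_index hζ.measurableSet
  let η : ℕ → Ω → E := fun n => n.casesOn ζ fun _ => η₀
  have hηm : ∀ n, Measurable[H] (η n)
    | 0 => hζ.measurable
    | _ + 1 => hη₀.1
  have hsel : (fun ω => η (j ω) ω) ∈ selections H μ Y := ⟨measurable_apply_index hj hηm, by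
    filter_upwards [hζ.ae_mem, hη₀Y.2] with ω h1 h2
    by_cases hω : ω ∈ D
    · rw [hj0 ω hω]
      exact h1 hω
    · rw [hj1 ω hω]
      exact h2⟩
  rw [hY.selections_eq] at hsel
  have hmem := ae_mem_of_mem_closureInProbability hM.isRandomClosedSet.2
    (by
      rintro θ ⟨ξ, hξ, hθ⟩
      refine hθ.ae_mem_of_convex hH hξ.1.1 hM.isRandomClosedSet hM.convex ?_
      filter_upwards [hξ.1.2, hM.subset] with ω h1 h2 using h2 h1) hsel
  filter_upwards [hmem] with ω h hω
  rw [hj0 ω hω] at h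
  exact h

end Inclusions

end RandomSets

theorem proposition6p7 {Ω E : Type*}
    [NormedAddCommGroup E] [NormedSpace ℝ E] [CompleteSpace E]
    [TopologicalSpace.SeparableSpace E] [MeasurableSpace E] [BorelSpace E]
    (H : MeasurableSpace Ω) [mΩ : MeasurableSpace Ω] (hH : H ≤ mΩ)
    (μ : Measure Ω) [IsProbabilityMeasure μ] [μ.IsComplete]
    (X : Ω → Set E) (hX : RandomSets.IsRandomClosedSet mΩ μ X)
    (hne : ∀ᵐ ω ∂μ, (X ω).Nonempty)
    (hint : (RandomSets.condIntegrableSelections H μ X).Nonempty) :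
    (∃ C, RandomSets.IsCondCore H μ X C) ∧
    (∃ Y, RandomSets.IsGenCondExpSet H μ X Y) ∧
    (∃ M, RandomSets.IsCondConvexHull H μ X M) ∧
    ∀ C Y M : Ω → Set E, RandomSets.IsCondCore H μ X C → RandomSets.IsGenCondExpSet H μ X Y →
      RandomSets.IsCondConvexHull H μ X M →
        ∀ᵐ ω ∂μ, C ω ⊆ Y ω ∧ Y ω ⊆ M ω := by
  refine ⟨RandomSets.exists_isCondCore hH hX.2, RandomSets.exists_isGenCondExpSet hH hint,
    RandomSets.exists_isCondConvexHull hH μ X, fun C Y M hC hY hM => ?_⟩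
  filter_upwards [hC.ae_subset_genCondExpSet hH hint hY,
    hY.ae_subset_condConvexHull hH hint hM] with ω h1 h2 using ⟨h1, h2⟩
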